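/- Let $\mathbb K$ be $\mathbb R$ or $\mathbb C$ and let $X$ be a Banach space over $\mathbb K$, with dual $X^\ast$. For a Banach space $Y$ over $\mathbb K$, let $\mathrm{Lip}_0(X,Y)$ be the space of Lipschitz maps $F\colon X\to Y$ with $F(0)=0$, normed by $\|F\|_L=\sup\{\|F(x)-F(y)\|/\|x-y\| : x,y\in X,\ x\neq y\}$. For $x\in X$ let $\delta_x\in \mathrm{Lip}_0(X,\mathbb K)^\ast$ be the evaluation functional $\delta_x(f)=f(x)$, and let $$\mathcal F(X)=\overline{\mathrm{span}}\{\delta_x : x\in X\}\subseteq \mathrm{Lip}_0(X,\mathbb K)^\ast$$ (closure in the dual norm) be the Lipschitz free space over $X$. Let $\mathcal L(\mathcal F(X),X)$ be the space of bounded linear operators $\mathcal F(X)\to X$ with the operator norm. For $F\in \mathrm{Lip}_0(X,X)$, let $T_F\in\mathcal L(\mathcal F(X),X)$ be the unique bounded linear operator with $T_F(\delta_x)=F(x)$ for all $x\in X$, and let $\mathcal G_X=T_{\mathrm{Id}}$ be the operator so associated with the identity map $\mathrm{Id}$ of $X$, that is, $\mathcal G_X(\delta_x)=x$ for all $x\in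 X$. For a normed space $Z$ over $\mathbb K$ and $u,z\in Z$ put $$V(Z,u,z)=\{\varphi(z) : \varphi\in Z^\ast,\ \|\varphi\|=1,\ \varphi(u)=1\}.$$ The Lipschitz numerical range of $F\in \mathrm{Lip}_0(X,X)$ is $$W_L(F)=\left\{\frac{\xi^\ast(F(x)-F(y))}{\|x-y\|} : \xi^\ast\in X^\ast,\ \|\xi^\ast\|=1,\ x,y\in X,\ x\neq y,\ \xi^\ast(x-y)=\|x-y\|\right\}.$$ Then, for every $F\in \mathrm{Lip}_0(X,X)$, $$\overline{\mathrm{conv}}\,(W_L(F))=V(\mathcal L(\mathcal F(X),X),\mathcal G_X,T_F)=V(\mathrm{Lip}_0(X,X),\mathrm{Id},F).$$ -/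

import Mathlib

open scoped NNReal

namespace LipFree

/-- The linear space of Lipschitz maps `F : X → Y` with `F 0 = 0`. -/
def lip0Submodule (𝕜 X Y : Type*) [RCLike 𝕜] [NormedAddCommGroup X] [NormedAddCommGroup Y]
    [NormedSpace 𝕜 Y] : Submodule 𝕜 (X → Y) where
  carrier := {F | F 0 = 0 ∧ ∃ K : ℝ≥0, LipschitzWith K F}
  zero_mem' := ⟨rfl, 0, LipschitzWith.const 0⟩
  add_mem' := by
    rintro F G ⟨hF, K, hK⟩ ⟨hG, L, hL⟩
    exact ⟨by simp [hF, hG], K + L, hK.add hL⟩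
  smul_mem' := by
    rintro c F ⟨hF, K, hK⟩
    refine ⟨by simp [hF], ‖c‖₊ * K, LipschitzWith.of_dist_le_mul fun x y => ?_⟩
    have h := hK.dist_le_mul x y
    simp only [Pi.smul_apply, dist_smul₀, NNReal.coe_mul, coe_nnnorm]
    rw [mul_assoc]
    exact mul_le_mul_of_nonneg_left h (norm_nonneg c)

/-- `Lip₀(X, Y)`. It is a type synonym, so that its topology is that of the Lipschitz norm below
and not the topology of pointwise convergence. -/
def Lip0 (𝕜 X Y : Type*) [RCLike 𝕜] [NormedAddCommGroup X] [NormedAddCommGroup Y]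
    [NormedSpace 𝕜 Y] : Type _ :=
  lip0Submodule 𝕜 X Y

section Lip0

variable {𝕜 X Y : Type*} [RCLike 𝕜] [NormedAddCommGroup X] [NormedAddCommGroup Y]
  [NormedSpace 𝕜 Y]

instance : AddCommGroup (Lip0 𝕜 X Y) := inferInstanceAs (AddCommGroup (lip0Submodule 𝕜 X Y))

instance : Module 𝕜 (Lip0 𝕜 X Y) := inferInstanceAs (Module 𝕜 (lip0Submodule 𝕜 X Y))

instance : FunLike (Lip0 𝕜 X Y) X Y where
  coe F := F.1
  coe_injective _ _ h := Subtype.ext h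

/-- Bundling a Lipschitz map that vanishes at `0`. -/
def Lip0.mk (F : X → Y) (h0 : F 0 = 0) (hF : ∃ K : ℝ≥0, LipschitzWith K F) : Lip0 𝕜 X Y :=
  ⟨F, h0, hF⟩

@[simp] theorem Lip0.mk_apply (F : X → Y) (h0 : F 0 = 0) (hF : ∃ K : ℝ≥0, LipschitzWith K F)
    (x : X) : (Lip0.mk F h0 hF : Lip0 𝕜 X Y) x = F x := rfl

@[ext] theorem Lip0.ext {F G : Lip0 𝕜 X Y} (h : ∀ x, F x = G x) : F = G := DFunLike.ext F G h

@[simp] theorem Lip0.map_zero (F : Lip0 𝕜 X Y) : F 0 = 0 := F.2.1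

@[simp] theorem Lip0.zero_apply (x : X) : (0 : Lip0 𝕜 X Y) x = 0 := rfl

@[simp] theorem Lip0.add_apply (F G : Lip0 𝕜 X Y) (x : X) : (F + G) x = F x + G x := rfl

@[simp] theorem Lip0.smul_apply (c : 𝕜) (F : Lip0 𝕜 X Y) (x : X) : (c • F) x = c • F x := rfl

theorem Lip0.exists_lipschitz (F : Lip0 𝕜 X Y) : ∃ K : ℝ≥0, LipschitzWith K F := F.2.2

/-- The Lipschitz norm `‖F‖_L = sup {‖F x - F y‖ / ‖x - y‖ : x ≠ y}`. -/
noncomputable instance : Norm (Lip0 𝕜 X Y) where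
  norm F := sSup {r : ℝ | ∃ x y : X, x ≠ y ∧ r = ‖F x - F y‖ / ‖x - y‖}

theorem Lip0.norm_def (F : Lip0 𝕜 X Y) :
    ‖F‖ = sSup {r : ℝ | ∃ x y : X, x ≠ y ∧ r = ‖F x - F y‖ / ‖x - y‖} := rfl

theorem Lip0.norm_nonneg' (F : Lip0 𝕜 X Y) : 0 ≤ ‖F‖ := by
  rw [Lip0.norm_def]
  apply Real.sSup_nonneg
  rintro r ⟨x, y, -, rfl⟩
  positivity

theorem Lip0.bddAbove (F : Lip0 𝕜 X Y) :
    BddAbove {r : ℝ | ∃ x y : X, x ≠ y ∧ r = ‖F x - F y‖ / ‖x - y‖} := by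
  obtain ⟨K, hK⟩ := F.exists_lipschitz
  refine ⟨K, ?_⟩
  rintro r ⟨x, y, hxy, rfl⟩
  rw [div_le_iff₀ (norm_pos_iff.2 (sub_ne_zero.2 hxy))]
  simpa [dist_eq_norm] using hK.dist_le_mul x y

theorem Lip0.norm_sub_le (F : Lip0 𝕜 X Y) (x y : X) : ‖F x - F y‖ ≤ ‖F‖ * ‖x - y‖ := by
  by_cases hxy : x = y
  · simp [hxy]
  · rw [← div_le_iff₀ (norm_pos_iff.2 (sub_ne_zero.2 hxy))]
    exact le_csSup F.bddAbove ⟨x, y, hxy, rfl⟩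

theorem Lip0.norm_apply_le (F : Lip0 𝕜 X Y) (x : X) : ‖F x‖ ≤ ‖F‖ * ‖x‖ := by
  simpa using F.norm_sub_le x 0

theorem Lip0.norm_le (F : Lip0 𝕜 X Y) {C : ℝ} (hC : 0 ≤ C)
    (h : ∀ x y, ‖F x - F y‖ ≤ C * ‖x - y‖) : ‖F‖ ≤ C := by
  rw [Lip0.norm_def]
  apply Real.sSup_le _ hC
  rintro r ⟨x, y, hxy, rfl⟩
  rw [div_le_iff₀ (norm_pos_iff.2 (sub_ne_zero.2 hxy))]
  exact h x y

theorem Lip0.normedSpaceCore : NormedSpace.Core 𝕜 (Lip0 𝕜 X Y) where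
  norm_nonneg := Lip0.norm_nonneg'
  norm_smul c F := by
    have key : ∀ (c : 𝕜) (F : Lip0 𝕜 X Y), ‖c • F‖ ≤ ‖c‖ * ‖F‖ := fun c F => by
      refine Lip0.norm_le _ (mul_nonneg (norm_nonneg c) F.norm_nonneg') fun x y => ?_
      rw [Lip0.smul_apply, Lip0.smul_apply, ← smul_sub, norm_smul, mul_assoc]
      exact mul_le_mul_of_nonneg_left (F.norm_sub_le x y) (norm_nonneg c)
    refine le_antisymm (key c F) ?_
    by_cases hc : c = 0
    · simpa [hc] using Lip0.norm_nonneg' (0 : Lip0 𝕜 X Y)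
    · have h := key c⁻¹ (c • F)
      rw [smul_smul, inv_mul_cancel₀ hc, one_smul, norm_inv] at h
      rwa [← le_inv_mul_iff₀ (norm_pos_iff.2 hc)]
  norm_triangle F G := by
    refine Lip0.norm_le _ (add_nonneg F.norm_nonneg' G.norm_nonneg') fun x y => ?_
    rw [Lip0.add_apply, Lip0.add_apply, add_sub_add_comm, add_mul]
    exact (norm_add_le _ _).trans (add_le_add (F.norm_sub_le x y) (G.norm_sub_le x y))
  norm_eq_zero_iff F := by
    constructor
    · intro h
      ext x
      simpa [h] using F.norm_apply_le x
    · rintro rfl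
      exact le_antisymm (Lip0.norm_le _ le_rfl fun x y => by simp) (Lip0.norm_nonneg' _)

noncomputable instance : NormedAddCommGroup (Lip0 𝕜 X Y) :=
  NormedAddCommGroup.ofCore (Lip0.normedSpaceCore (𝕜 := 𝕜))

noncomputable instance : NormedSpace 𝕜 (Lip0 𝕜 X Y) :=
  NormedSpace.ofCore (Lip0.normedSpaceCore (𝕜 := 𝕜))

end Lip0

/-- The identity map, as an element of `Lip₀(X, X)`. -/
def lip0Id (𝕜 X : Type*) [RCLike 𝕜] [NormedAddCommGroup X] [NormedSpace 𝕜 X] : Lip0 𝕜 X X :=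
  Lip0.mk id rfl ⟨1, LipschitzWith.id⟩

section FreeSpace

variable (𝕜 : Type*) {X : Type*} [RCLike 𝕜] [NormedAddCommGroup X]

/-- The evaluation functional `δ_x : f ↦ f x` on `Lip₀(X, 𝕜)`. -/
noncomputable def evalFunctional (x : X) : StrongDual 𝕜 (Lip0 𝕜 X 𝕜) :=
  LinearMap.mkContinuous
    { toFun := fun f => f x
      map_add' := fun _ _ => rfl
      map_smul' := fun _ _ => rfl } ‖x‖
    (fun f => (f.norm_apply_le x).trans_eq (mul_comm _ _))

@[simp] theorem evalFunctional_apply (x : X) (f : Lip0 𝕜 X 𝕜) : evalFunctional 𝕜 x f = f x := rfl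

variable (X) in
/-- The norm-closed linear span of the evaluation functionals in the dual of `Lip₀(X, 𝕜)`. -/
noncomputable def freeSubmodule : Submodule 𝕜 (StrongDual 𝕜 (Lip0 𝕜 X 𝕜)) :=
  (Submodule.span 𝕜 (Set.range (evalFunctional 𝕜 (X := X)))).topologicalClosure

variable (X) in
/-- The Lipschitz free space `𝓕(X)`: the norm-closed linear span of the evaluation functionals
in the dual of `Lip₀(X, 𝕜)`, with the dual norm. -/
def FreeSpace : Type _ := freeSubmodule 𝕜 X

noncomputable instance : NormedAddCommGroup (FreeSpace 𝕜 X) :=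
  inferInstanceAs (NormedAddCommGroup (freeSubmodule 𝕜 X))

noncomputable instance : NormedSpace 𝕜 (FreeSpace 𝕜 X) :=
  inferInstanceAs (NormedSpace 𝕜 (freeSubmodule 𝕜 X))

variable (X) in
/-- The isometric inclusion of the free space in the dual of `Lip₀(X, 𝕜)`. -/
noncomputable def FreeSpace.incl : FreeSpace 𝕜 X →ₗᵢ[𝕜] StrongDual 𝕜 (Lip0 𝕜 X 𝕜) where
  toFun m := m.1
  map_add' _ _ := rfl
  map_smul' _ _ := rfl
  norm_map' _ := rfl

/-- The canonical embedding `δ : X → 𝓕(X)`. -/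
noncomputable def delta (x : X) : FreeSpace 𝕜 X :=
  ⟨evalFunctional 𝕜 x,
    Submodule.le_topologicalClosure _ (Submodule.subset_span (Set.mem_range_self x))⟩

@[simp] theorem incl_delta (x : X) : FreeSpace.incl 𝕜 X (delta 𝕜 x) = evalFunctional 𝕜 x := rfl

variable {𝕜}

/-- A closed subspace of the free space that contains all `δ_x` is the whole free space. -/
theorem FreeSpace.mem_of_isClosed {p : Submodule 𝕜 (FreeSpace 𝕜 X)} (hp : IsClosed (p : Set (FreeSpace 𝕜 X)))
    (h : ∀ x : X, delta 𝕜 x ∈ p) (m : FreeSpace 𝕜 X) : m ∈ p := by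
  have hs : ∀ v (hv : v ∈ Submodule.span 𝕜 (Set.range (evalFunctional 𝕜 (X := X)))),
      (⟨v, Submodule.le_topologicalClosure _ hv⟩ : FreeSpace 𝕜 X) ∈ p := by
    intro v hv
    induction hv using Submodule.span_induction with
    | mem v hv =>
      obtain ⟨x, rfl⟩ := hv
      exact h x
    | zero => exact p.zero_mem
    | add v w hv hw ihv ihw => exact p.add_mem ihv ihw
    | smul c v hv ih => exact p.smul_mem c ih
  change m ∈ (p : Set (FreeSpace 𝕜 X))
  rw [← hp.closure_eq, Metric.mem_closure_iff]
  intro ε hε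
  have hm' : m.1 ∈ closure
      (Submodule.span 𝕜 (Set.range (evalFunctional 𝕜 (X := X))) :
        Set (StrongDual 𝕜 (Lip0 𝕜 X 𝕜))) := m.2
  obtain ⟨v, hv, hd⟩ := Metric.mem_closure_iff.1 hm' ε hε
  exact ⟨⟨v, Submodule.le_topologicalClosure _ hv⟩, hs v hv, hd⟩

variable {Y : Type*} [NormedAddCommGroup Y] [NormedSpace 𝕜 Y]

/-- The scalar map `y* ∘ F`, for `F` in `Lip₀(X, Y)` and `y*` in the dual of `Y`. -/
noncomputable def Lip0.comp (F : Lip0 𝕜 X Y) (g : StrongDual 𝕜 Y) : Lip0 𝕜 X 𝕜 :=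
  Lip0.mk (fun x => g (F x)) (by simp)
    (by obtain ⟨K, hK⟩ := F.exists_lipschitz; exact ⟨‖g‖₊ * K, g.lipschitz.comp hK⟩)

@[simp] theorem Lip0.comp_apply (F : Lip0 𝕜 X Y) (g : StrongDual 𝕜 Y) (x : X) :
    F.comp g x = g (F x) := rfl

theorem Lip0.norm_comp_le (F : Lip0 𝕜 X Y) (g : StrongDual 𝕜 Y) : ‖F.comp g‖ ≤ ‖F‖ * ‖g‖ := by
  refine Lip0.norm_le _ (by positivity) fun x y => ?_
  rw [Lip0.comp_apply, Lip0.comp_apply, ← map_sub]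
  calc ‖g (F x - F y)‖ ≤ ‖g‖ * ‖F x - F y‖ := g.le_opNorm _
    _ ≤ ‖g‖ * (‖F‖ * ‖x - y‖) := by gcongr; exact F.norm_sub_le x y
    _ = ‖F‖ * ‖g‖ * ‖x - y‖ := by ring

/-- Every `F` in `Lip₀(X, Y)`, with `Y` complete, extends through `δ` to a bounded linear operator
on the free space. -/
theorem exists_linearisation [CompleteSpace Y] (F : Lip0 𝕜 X Y) :
    ∃ T : FreeSpace 𝕜 X →L[𝕜] Y, ∀ x, T (delta 𝕜 x) = F x := by
  let A : StrongDual 𝕜 Y →L[𝕜] Lip0 𝕜 X 𝕜 := LinearMap.mkContinuous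
    { toFun := F.comp
      map_add' := fun _ _ => rfl
      map_smul' := fun _ _ => rfl } ‖F‖ F.norm_comp_le
  let J : Y →ₗᵢ[𝕜] StrongDual 𝕜 (StrongDual 𝕜 Y) := NormedSpace.inclusionInDoubleDualLi 𝕜
  let B : FreeSpace 𝕜 X →ₗ[𝕜] StrongDual 𝕜 (StrongDual 𝕜 Y) :=
    { toFun := fun m => (FreeSpace.incl 𝕜 X m).comp A
      map_add' := fun _ _ => rfl
      map_smul' := fun _ _ => rfl }
  have hB' : ∀ m, ‖B m‖ ≤ ‖A‖ * ‖m‖ := fun m =>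
    ((FreeSpace.incl 𝕜 X m).opNorm_comp_le A).trans_eq (mul_comm _ _)
  have hBδ : ∀ x, B (delta 𝕜 x) = J (F x) := fun x => rfl
  have hB : ∀ m, ∃ y, J y = B m := by
    have hcl : IsClosed (Set.range J) := J.isometry.isUniformInducing.isComplete_range.isClosed
    exact FreeSpace.mem_of_isClosed (p := (LinearMap.range J.toLinearMap).comap B)
      (hcl.preimage (AddMonoidHomClass.continuous_of_bound B _ hB')) fun x => ⟨F x, (hBδ x).symm⟩
  choose T hT using hB
  refine ⟨LinearMap.mkContinuous
    { toFun := T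
      map_add' := fun m n => J.injective (by simp only [map_add, hT])
      map_smul' := fun c m => J.injective (by simp only [map_smul, hT, RingHom.id_apply]) }
    ‖A‖ (fun m => ?_), fun x => J.injective ((hT _).trans (hBδ x))⟩
  rw [LinearMap.coe_mk, AddHom.coe_mk, ← J.norm_map, hT]
  exact hB' m

theorem linearisation_unique {S T : FreeSpace 𝕜 X →L[𝕜] Y}
    (h : ∀ x, S (delta 𝕜 x) = T (delta 𝕜 x)) : S = T := by
  ext m
  exact FreeSpace.mem_of_isClosed (p := LinearMap.eqLocus S.toLinearMap T.toLinearMap)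
    (isClosed_eq S.continuous T.continuous) h m

/-- The linearisation `T_F : 𝓕(X) → Y` of `F`: the unique bounded linear operator with
`T_F ∘ δ = F`. -/
noncomputable def linearisation [CompleteSpace Y] (F : Lip0 𝕜 X Y) : FreeSpace 𝕜 X →L[𝕜] Y :=
  Classical.choose (exists_linearisation F)

@[simp] theorem linearisation_delta [CompleteSpace Y] (F : Lip0 𝕜 X Y) (x : X) :
    linearisation F (delta 𝕜 x) = F x :=
  Classical.choose_spec (exists_linearisation F) x

theorem norm_delta_sub_le (x y : X) : ‖delta 𝕜 x - delta 𝕜 y‖ ≤ ‖x - y‖ := by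
  refine ContinuousLinearMap.opNorm_le_bound
    (evalFunctional 𝕜 x - evalFunctional 𝕜 y) (norm_nonneg _) fun f => ?_
  exact (f.norm_sub_le x y).trans_eq (mul_comm _ _)

/-- The linearisation preserves the norm. -/
theorem norm_linearisation [CompleteSpace Y] (F : Lip0 𝕜 X Y) : ‖linearisation F‖ = ‖F‖ := by
  apply le_antisymm
  · refine ContinuousLinearMap.opNorm_le_bound _ (norm_nonneg F) fun m => ?_
    refine NormedSpace.norm_le_dual_bound 𝕜 _ (by positivity) fun g => ?_
    have hg : g (linearisation F m) = FreeSpace.incl 𝕜 X m (F.comp g) := by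
      refine FreeSpace.mem_of_isClosed (p := LinearMap.eqLocus (g.comp (linearisation F)).toLinearMap
        ((ContinuousLinearMap.apply 𝕜 𝕜 (F.comp g)).comp (FreeSpace.incl 𝕜 X).toContinuousLinearMap).toLinearMap)
        (isClosed_eq (ContinuousLinearMap.continuous _) (ContinuousLinearMap.continuous _))
        (fun x => ?_) m
      simp
    rw [hg]
    calc ‖FreeSpace.incl 𝕜 X m (F.comp g)‖ ≤ ‖FreeSpace.incl 𝕜 X m‖ * ‖F.comp g‖ := (FreeSpace.incl 𝕜 X m).le_opNorm _
      _ ≤ ‖FreeSpace.incl 𝕜 X m‖ * (‖F‖ * ‖g‖) := by gcongr; exact F.norm_comp_le g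
      _ = ‖F‖ * ‖m‖ * ‖g‖ := by rw [LinearIsometry.norm_map]; ring
  · refine Lip0.norm_le _ (norm_nonneg _) fun x y => ?_
    rw [← linearisation_delta F x, ← linearisation_delta F y, ← map_sub]
    exact (ContinuousLinearMap.le_opNorm _ _).trans
      (mul_le_mul_of_nonneg_left (norm_delta_sub_le x y) (norm_nonneg _))

end FreeSpace

section NumericalRange

variable {𝕜 X : Type*} [RCLike 𝕜] [NormedAddCommGroup X] [NormedSpace 𝕜 X]

variable (𝕜 X) in
/-- The canonical quotient map `𝓖_X : 𝓕(X) → X`, the linearisation of the identity; it is the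
bounded linear operator with `𝓖_X (δ_x) = x`. -/
noncomputable def canonicalQuotient [CompleteSpace X] : FreeSpace 𝕜 X →L[𝕜] X :=
  linearisation (lip0Id 𝕜 X)

theorem norm_lip0Id [Nontrivial X] : ‖lip0Id 𝕜 X‖ = 1 := by
  apply le_antisymm
  · exact Lip0.norm_le _ zero_le_one fun x y => by simp [lip0Id]
  · obtain ⟨x, hx⟩ := exists_ne (0 : X)
    have h := (lip0Id 𝕜 X).norm_apply_le x
    have hx' := norm_pos_iff.2 hx
    simp only [lip0Id, Lip0.mk_apply, id] at h
    exact (le_mul_iff_one_le_left hx').1 h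

theorem norm_canonicalQuotient [CompleteSpace X] [Nontrivial X] : ‖canonicalQuotient 𝕜 X‖ = 1 :=
  (norm_linearisation _).trans norm_lip0Id

/-- The numerical range `V(Z, u, z) = {φ(z) : φ ∈ Z*, ‖φ‖ = 1, φ(u) = 1}` of `z` with respect
to `(Z, u)`, where `u` is meant to have norm one. -/
def numericalRange (𝕜 : Type*) [RCLike 𝕜] (Z : Type*) [NormedAddCommGroup Z] [NormedSpace 𝕜 Z]
    (u z : Z) : Set 𝕜 :=
  {c | ∃ φ : StrongDual 𝕜 Z, ‖φ‖ = 1 ∧ φ u = 1 ∧ c = φ z}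

/-- The Lipschitz numerical range `W_L(F)`: the scalars `ξ (F x - F y) / ‖x - y‖`, where
`x ≠ y`, `ξ ∈ X*`, `‖ξ‖ = 1` and `ξ (x - y) = ‖x - y‖`. -/
def lipNumericalRange (F : Lip0 𝕜 X X) : Set 𝕜 :=
  {c | ∃ (ξ : StrongDual 𝕜 X) (x y : X), ‖ξ‖ = 1 ∧ x ≠ y ∧ ξ (x - y) = ((‖x - y‖ : ℝ) : 𝕜) ∧
    c = ξ (F x - F y) / ((‖x - y‖ : ℝ) : 𝕜)}

end NumericalRange

end LipFree

/-!
The second equality holds because linearisation `F ↦ T_F` is a surjective linear isometry from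
`Lip₀(X, X)` onto `𝓛(𝓕(X), X)` carrying the identity to `𝓖_X`, and numerical ranges are invariant
under such maps (`numericalRange_map`). It remains to identify `V(Lip₀(X, X), Id, F)` with the
closed convex hull of `W_L(F)`.

The range `V(Lip₀(X, X), Id, F)` is convex, compact by Banach–Alaoglu, and contains `W_L(F)`,
since `G ↦ ξ (G x - G y) / ‖x - y‖` is a state at the identity whenever `ξ` is a norm-one functional
attaining its norm at `x - y`.

For the opposite inclusion, by Hahn–Banach separation in `𝕜`, it is enough that an upper bound `θ`
for `Re W_L(F)` bounds `Re V(Lip₀(X, X), Id, F)` as well. For a state `φ` and `t > 0` one has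
`1 + t Re φ(F) ≤ ‖Id + t F‖`, so the claim follows from `‖Id + t F‖ ≤ 1 + t θ + O(t²)`
(`norm_lip0Id_add_smul_le`). To see the latter, let `u = x - y`, `w = F x - F y`, and let `ξ` be a
norming functional of `u + t w`. Then `ξ` attains its norm at the difference of the *shifted* points
`x + t w` and `y`, so that `Re ξ (F (x + t w) - F y) ≤ θ ‖u + t w‖`; and `F (x + t w)` differs from
`F x` by at most `t ‖F‖² ‖u‖`. Shifting one of the points takes the place of an appeal to the
Bishop–Phelps–Bollobás theorem.
-/

namespace LipFree

/-! ### Numerical ranges in normed spaces -/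

section NormedSpace

variable {𝕜 Z Z' : Type*} [RCLike 𝕜] [NormedAddCommGroup Z] [NormedSpace 𝕜 Z]
  [NormedAddCommGroup Z'] [NormedSpace 𝕜 Z']

theorem numericalRange_subset_map (e : Z ≃ₗᵢ[𝕜] Z') (u z : Z) :
    numericalRange 𝕜 Z u z ⊆ numericalRange 𝕜 Z' (e u) (e z) := by
  rintro c ⟨φ, hφ, hu, rfl⟩
  refine ⟨φ.comp (e.symm : Z' →L[𝕜] Z), ?_, by simp [hu], by simp⟩
  rw [← hφ]
  exact ContinuousLinearMap.opNorm_comp_linearIsometryEquiv φ e.symm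

theorem numericalRange_map (e : Z ≃ₗᵢ[𝕜] Z') (u z : Z) :
    numericalRange 𝕜 Z' (e u) (e z) = numericalRange 𝕜 Z u z := by
  refine Set.Subset.antisymm ?_ (numericalRange_subset_map e u z)
  simpa using numericalRange_subset_map e.symm (e u) (e z)

/-- At a point `u` of norm one, the functionals in the definition of the numerical range are those
of norm at most one that take the value `1` at `u`. -/
theorem mem_numericalRange_of_norm_le_one {u z : Z} (hu : ‖u‖ = 1) {φ : StrongDual 𝕜 Z}
    (hφ : ‖φ‖ ≤ 1) (hφu : φ u = 1) : φ z ∈ numericalRange 𝕜 Z u z := by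
  refine ⟨φ, le_antisymm hφ ?_, hφu, rfl⟩
  simpa [hφu, hu] using φ.le_opNorm u

theorem convex_numericalRange {u : Z} (hu : ‖u‖ = 1) (z : Z) :
    Convex ℝ (numericalRange 𝕜 Z u z) := by
  rintro _ ⟨φ, hφ, hφu, rfl⟩ _ ⟨ψ, hψ, hψu, rfl⟩ a b ha hb hab
  have hz : ∀ v : Z, a • φ v + b • ψ v = ((a : 𝕜) • φ + (b : 𝕜) • ψ) v := fun v => by
    simp [RCLike.real_smul_eq_coe_mul]
  rw [hz]
  refine mem_numericalRange_of_norm_le_one hu ?_ ?_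
  · refine (norm_add_le _ _).trans ?_
    simp [norm_smul, hφ, hψ, abs_of_nonneg ha, abs_of_nonneg hb, hab]
  · rw [← hz, hφu, hψu, ← add_smul, hab, one_smul]

theorem isCompact_numericalRange {u : Z} (hu : ‖u‖ = 1) (z : Z) :
    IsCompact (numericalRange 𝕜 Z u z) := by
  have hK : IsCompact ((WeakDual.toStrongDual ⁻¹' Metric.closedBall (0 : StrongDual 𝕜 Z) 1) ∩
      {φ : WeakDual 𝕜 Z | φ u = 1}) :=
    (WeakDual.isCompact_closedBall (𝕜 := 𝕜) (0 : StrongDual 𝕜 Z) 1).inter_right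
      (isClosed_singleton.preimage (WeakDual.eval_continuous u))
  convert hK.image (WeakDual.eval_continuous z) using 1
  ext c
  constructor
  · rintro ⟨φ, hφ, hφu, rfl⟩
    exact ⟨StrongDual.toWeakDual φ, ⟨mem_closedBall_zero_iff.2 hφ.le, hφu⟩, rfl⟩
  · rintro ⟨φ, ⟨hφ, hφu⟩, rfl⟩
    exact mem_numericalRange_of_norm_le_one hu (mem_closedBall_zero_iff.1 hφ) hφu

end NormedSpace

/-! ### The identification of `Lip₀(X, Y)` with `𝓛(𝓕(X), Y)` -/

section Linearisation

variable {𝕜 X Y : Type*} [RCLike 𝕜] [NormedAddCommGroup X] [NormedAddCommGroup Y]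
  [NormedSpace 𝕜 Y]

/-- The Lipschitz map `T ∘ δ`, for an operator `T` on the free space. -/
noncomputable def compDelta (T : FreeSpace 𝕜 X →L[𝕜] Y) : Lip0 𝕜 X Y :=
  Lip0.mk (fun x => T (delta 𝕜 x))
    (by
      have h : delta 𝕜 (0 : X) = 0 := (FreeSpace.incl 𝕜 X).injective (by ext f; simp)
      rw [h, map_zero])
    ⟨‖T‖₊, T.lipschitz.comp (LipschitzWith.mk_one fun x y => by
      simpa only [dist_eq_norm] using norm_delta_sub_le x y) |>.weaken (by simp)⟩

/-- Linearisation, as an isometric isomorphism of `Lip₀(X, Y)` with `𝓛(𝓕(X), Y)`. -/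
noncomputable def linearisationEquiv [CompleteSpace Y] :
    Lip0 𝕜 X Y ≃ₗᵢ[𝕜] (FreeSpace 𝕜 X →L[𝕜] Y) where
  toFun := linearisation
  map_add' F G := linearisation_unique fun x => by simp
  map_smul' c F := linearisation_unique fun x => by simp
  invFun := compDelta
  left_inv F := by ext x; simp [compDelta]
  right_inv T := linearisation_unique fun x => by simp [compDelta]
  norm_map' := norm_linearisation

end Linearisation

/-! ### The Lipschitz numerical range -/

section LipschitzRange

variable {𝕜 X : Type*} [RCLike 𝕜] [NormedAddCommGroup X] [NormedSpace 𝕜 X]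

theorem lipNumericalRange_subset_numericalRange (F : Lip0 𝕜 X X) :
    lipNumericalRange F ⊆ numericalRange 𝕜 (Lip0 𝕜 X X) (lip0Id 𝕜 X) F := by
  rintro c ⟨ξ, x, y, hξ, hxy, hξxy, rfl⟩
  have : Nontrivial X := ⟨x, y, hxy⟩
  have hpos : 0 < ‖x - y‖ := norm_pos_iff.2 (sub_ne_zero.2 hxy)
  have hne : ((‖x - y‖ : ℝ) : 𝕜) ≠ 0 := RCLike.ofReal_ne_zero.2 hpos.ne'
  let φ₀ : Lip0 𝕜 X X →ₗ[𝕜] 𝕜 :=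
    { toFun := fun G => ξ (G x - G y) / ((‖x - y‖ : ℝ) : 𝕜)
      map_add' := fun G H => by simp only [Lip0.add_apply, map_sub, map_add]; ring
      map_smul' := fun a G => by
        simp only [Lip0.smul_apply, map_sub, map_smul, smul_eq_mul, RingHom.id_apply]; ring }
  have hφ₀ : ∀ G, ‖φ₀ G‖ ≤ 1 * ‖G‖ := fun G => by
    change ‖ξ (G x - G y) / ((‖x - y‖ : ℝ) : 𝕜)‖ ≤ 1 * ‖G‖
    rw [norm_div, RCLike.norm_ofReal, abs_of_pos hpos, div_le_iff₀ hpos, one_mul]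
    refine (ξ.le_opNorm _).trans ?_
    rw [hξ, one_mul]
    exact G.norm_sub_le x y
  refine mem_numericalRange_of_norm_le_one (φ := φ₀.mkContinuous 1 hφ₀) norm_lip0Id
    (φ₀.mkContinuous_norm_le zero_le_one hφ₀) ?_
  change ξ (x - y) / ((‖x - y‖ : ℝ) : 𝕜) = 1
  rw [hξxy, div_self hne]

/-- If `θ` bounds `Re (ω W_L(F))` from above, then `‖Id + t ω F‖ ≤ 1 + t θ + O(t²)` as `t ↓ 0`. -/
theorem norm_lip0Id_add_smul_le (F : Lip0 𝕜 X X) (ω : 𝕜) {θ : ℝ}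
    (hθ : ∀ w ∈ lipNumericalRange F, RCLike.re (ω * w) ≤ θ) {t : ℝ} (ht : 0 ≤ t)
    (hpos : 0 ≤ 1 + t * θ) :
    ‖lip0Id 𝕜 X + (t : 𝕜) • ω • F‖ ≤
      1 + t * θ + t ^ 2 * (|θ| * (‖ω‖ * ‖F‖) + (‖ω‖ * ‖F‖) ^ 2) := by
  set L : ℝ := ‖ω‖ * ‖F‖ with hL
  have hL0 : 0 ≤ L := by positivity
  refine Lip0.norm_le _ (by positivity) fun x y => ?_
  set u := x - y with hu
  set w := ω • (F x - F y) with hw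
  have hwL : ‖w‖ ≤ L * ‖u‖ := by
    rw [hw, norm_smul, hL, mul_assoc]
    exact mul_le_mul_of_nonneg_left (F.norm_sub_le x y) (norm_nonneg _)
  have hdiff : (lip0Id 𝕜 X + (t : 𝕜) • ω • F) x - (lip0Id 𝕜 X + (t : 𝕜) • ω • F) y =
      u + (t : 𝕜) • w := by
    simp only [lip0Id, Lip0.add_apply, Lip0.smul_apply, Lip0.mk_apply, id, hu, hw, smul_sub]
    abel
  rw [hdiff]
  have hrhs : 0 ≤ (1 + t * θ + t ^ 2 * (|θ| * L + L ^ 2)) * ‖u‖ := by positivity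
  by_cases hv : u + (t : 𝕜) • w = 0
  · rw [hv, norm_zero]; exact hrhs
  obtain ⟨ξ, hξ, hξv⟩ := exists_dual_vector 𝕜 _ (norm_ne_zero_iff.2 hv)
  have htw : ‖(t : 𝕜) • w‖ = t * ‖w‖ := by
    rw [norm_smul, RCLike.norm_ofReal, abs_of_nonneg ht]
  -- `ξ` attains its norm at the difference of the shifted points `x + t w` and `y`.
  set x' := x + (t : 𝕜) • w with hx'
  have hx'y : x' - y = u + (t : 𝕜) • w := by rw [hx', hu]; abel
  have hvpos : 0 < ‖u + (t : 𝕜) • w‖ := norm_pos_iff.2 hv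
  have hmem := hθ _ ⟨ξ, x', y, hξ, sub_ne_zero.1 (hx'y ▸ hv), by rw [hx'y]; exact hξv, rfl⟩
  rw [hx'y, ← mul_div_assoc, div_eq_inv_mul, ← RCLike.ofReal_inv, RCLike.re_ofReal_mul,
    ← div_eq_inv_mul, div_le_iff₀ hvpos] at hmem
  have hre : ∀ v : X, RCLike.re (ξ v) ≤ ‖v‖ := fun v =>
    (RCLike.re_le_norm _).trans (by simpa [hξ] using ξ.le_opNorm v)
  have hshift : RCLike.re (ξ w) ≤
      RCLike.re (ω * ξ (F x' - F y)) + t * L ^ 2 * ‖u‖ := by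
    have hsplit : w = ω • (F x' - F y) + ω • (F x - F x') := by
      rw [hw, ← smul_add]; congr 1; abel
    have hsmall : ‖ω • (F x - F x')‖ ≤ t * L ^ 2 * ‖u‖ := by
      have hxx : x - x' = -((t : 𝕜) • w) := by rw [hx']; abel
      calc ‖ω • (F x - F x')‖ ≤ ‖ω‖ * (‖F‖ * ‖x - x'‖) := by
            rw [norm_smul]; exact mul_le_mul_of_nonneg_left (F.norm_sub_le x x') (norm_nonneg _)
        _ = L * t * ‖w‖ := by rw [hxx, norm_neg, htw, hL]; ring
        _ ≤ L * t * (L * ‖u‖) := by gcongr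
        _ = t * L ^ 2 * ‖u‖ := by ring
    calc RCLike.re (ξ w) = RCLike.re (ω * ξ (F x' - F y)) + RCLike.re (ξ (ω • (F x - F x'))) := by
          conv_lhs => rw [hsplit]
          rw [map_add, map_add, map_smul, smul_eq_mul]
      _ ≤ _ := by gcongr; exact (hre _).trans hsmall
  have hnorm : ‖u + (t : 𝕜) • w‖ = RCLike.re (ξ u) + t * RCLike.re (ξ w) := by
    have h := congrArg RCLike.re hξv
    rw [RCLike.ofReal_re, map_add, map_smul, smul_eq_mul, map_add, RCLike.re_ofReal_mul] at h
    exact h.symm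
  have hθv : θ * ‖u + (t : 𝕜) • w‖ ≤ θ * ‖u‖ + t * |θ| * L * ‖u‖ := by
    have h1 : |‖u + (t : 𝕜) • w‖ - ‖u‖| ≤ t * (L * ‖u‖) := by
      refine (abs_norm_sub_norm_le _ _).trans ?_
      rw [add_sub_cancel_left, htw]
      gcongr
    have h2 : θ * (‖u + (t : 𝕜) • w‖ - ‖u‖) ≤ |θ| * (t * (L * ‖u‖)) :=
      (le_abs_self _).trans (by rw [abs_mul]; gcongr)
    linarith
  calc ‖u + (t : 𝕜) • w‖ ≤ ‖u‖ + t * (θ * ‖u‖ + t * |θ| * L * ‖u‖ + t * L ^ 2 * ‖u‖) := by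
        rw [hnorm]
        gcongr
        · exact hre u
        · linarith
    _ = (1 + t * θ + t ^ 2 * (|θ| * L + L ^ 2)) * ‖u‖ := by ring

open Filter Topology in
theorem re_mul_le_of_mem_numericalRange (F : Lip0 𝕜 X X) (ω : 𝕜) {θ : ℝ}
    (hθ : ∀ w ∈ lipNumericalRange F, RCLike.re (ω * w) ≤ θ) {c : 𝕜}
    (hc : c ∈ numericalRange 𝕜 (Lip0 𝕜 X X) (lip0Id 𝕜 X) F) : RCLike.re (ω * c) ≤ θ := by
  obtain ⟨φ, hφ, hφ1, rfl⟩ := hc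
  set C : ℝ := |θ| * (‖ω‖ * ‖F‖) + (‖ω‖ * ‖F‖) ^ 2 with hC
  have hlim : Tendsto (fun t : ℝ => θ + t * C) (𝓝[>] 0) (𝓝 θ) := by
    have h : Continuous fun t : ℝ => θ + t * C := by fun_prop
    simpa using (h.tendsto 0).mono_left nhdsWithin_le_nhds
  have hpos : ∀ᶠ t : ℝ in 𝓝[>] 0, 0 < 1 + t * θ := by
    have h : Continuous fun t : ℝ => 1 + t * θ := by fun_prop
    exact ((h.tendsto 0).mono_left nhdsWithin_le_nhds).eventually (lt_mem_nhds (by simp))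
  refine ge_of_tendsto hlim ?_
  filter_upwards [hpos, self_mem_nhdsWithin] with t ht1 ht0
  have ht0 : 0 < t := ht0
  have h1 : RCLike.re (φ (lip0Id 𝕜 X + (t : 𝕜) • ω • F)) ≤ ‖lip0Id 𝕜 X + (t : 𝕜) • ω • F‖ :=
    (RCLike.re_le_norm _).trans ((φ.le_opNorm _).trans_eq (by rw [hφ, one_mul]))
  have h2 := h1.trans (norm_lip0Id_add_smul_le F ω hθ ht0.le ht1.le)
  rw [map_add, map_smul, map_smul, hφ1, smul_eq_mul, smul_eq_mul, map_add, RCLike.one_re,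
    RCLike.re_ofReal_mul, ← hC] at h2
  refine le_of_mul_le_mul_left ?_ ht0
  linarith

theorem closure_convexHull_lipNumericalRange (F : Lip0 𝕜 X X) :
    closure (convexHull ℝ (lipNumericalRange F)) =
      numericalRange 𝕜 (Lip0 𝕜 X X) (lip0Id 𝕜 X) F := by
  apply Set.Subset.antisymm
  · rcases subsingleton_or_nontrivial X with hX | hX
    · have h : lipNumericalRange F = ∅ :=
        Set.eq_empty_of_forall_notMem fun c ⟨_, x, y, _, hxy, _⟩ => hxy (Subsingleton.elim x y)
      simp [h]
    · exact closure_minimal (convexHull_min (lipNumericalRange_subset_numericalRange F)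
        (convex_numericalRange norm_lip0Id F)) (isCompact_numericalRange norm_lip0Id F).isClosed
  · intro c hc
    by_contra hcon
    obtain ⟨f, s, hs, hsc⟩ := RCLike.geometric_hahn_banach_closed_point (𝕜 := 𝕜)
      (convex_convexHull ℝ (lipNumericalRange F)).closure isClosed_closure hcon
    -- A `𝕜`-linear functional on `𝕜` is multiplication by its value at `1`.
    have hf : ∀ z, f z = f 1 * z := fun z => by
      rw [mul_comm, ← smul_eq_mul, ← map_smul, smul_eq_mul, mul_one]
    refine absurd (re_mul_le_of_mem_numericalRange F (f 1) (θ := s) (fun w hw => ?_) hc) ?_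
    · rw [← hf]
      exact (hs w (subset_closure (subset_convexHull ℝ _ hw))).le
    · rw [← hf]
      exact not_le.2 hsc

end LipschitzRange

end LipFree

theorem theorem5p2 {𝕜 X : Type*} [RCLike 𝕜] [NormedAddCommGroup X] [NormedSpace 𝕜 X]
    [CompleteSpace X] (F : LipFree.Lip0 𝕜 X X) :
    closure (convexHull ℝ (LipFree.lipNumericalRange F)) =
        LipFree.numericalRange 𝕜 (LipFree.FreeSpace 𝕜 X →L[𝕜] X)
          (LipFree.canonicalQuotient 𝕜 X) (LipFree.linearisation F) ∧
      LipFree.numericalRange 𝕜 (LipFree.FreeSpace 𝕜 X →L[𝕜] X)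
          (LipFree.canonicalQuotient 𝕜 X) (LipFree.linearisation F) =
        LipFree.numericalRange 𝕜 (LipFree.Lip0 𝕜 X X) (LipFree.lip0Id 𝕜 X) F := by
  have h := LipFree.numericalRange_map (LipFree.linearisationEquiv (𝕜 := 𝕜) (X := X) (Y := X))
    (LipFree.lip0Id 𝕜 X) F
  exact ⟨(LipFree.closure_convexHull_lipNumericalRange F).trans h.symm, h⟩
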